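/- Let $E$ be a non-empty set with a partial binary operation $(e,f)\mapsto ef$. Write $e\,\omega^l f$ if $ef$ is defined and $ef=e$; $e\,\omega^r f$ if $fe$ is defined and $fe=e$; $\omega=\omega^l\cap\omega^r$; $\mathcal R=\omega^r\cap(\omega^r)^{-1}$; $\omega^r(e)=\{f: f\,\omega^r e\}$ and $\omega^l(e)=\{f: f\,\omega^l e\}$. Put $M(e,f)=\omega^l(e)\cap\omega^r(f)$ and $$S(e,f)=\{h\in M(e,f): eg\,\omega^r eh \text{ and } gf\,\omega^l hf \text{ for all } g\in M(e,f)\}.$$ $E$ is a *biordered set* (Nambooripad) if the following hold together with their left-right duals: (B1) $\omega^l,\omega^r$ are quasi-orders, and $ef$ is defined if and only if $(e,f)\in(\omega^r\cup\omega^l)\cup(\omega^r\cup\omega^l)^{-1}$; (B21) $f\,\omega^r e$ implies $f\,\mathcal R\,fe\,\omega\,e$; (B22) $g\,\omega^l f$ and $f,g\in\omega^r(e)$ imply $ge\,\omega^l fe$; (B31) $g\,\omega^r f\,\omega^r e$ implies $gf=(ge)f$; (B32) $g\,\omega^l f$ and $f,g\in\omega^r(e)$ imply $(fg)e=(fe)(ge)$;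 (B4) $f,g\in\omega^r(e)$ implies $S(f,g)e=S(fe,ge)$. It is *regular* if $S(e,f)\neq\emptyset$ for all $e,f\in E$. **Proposition 5.2.** Let $E$ be a regular biordered set such that - (E1) there is an element $0\in E$ with $0\,\omega\,e$ for each $e\in E$; - (E2) there is a map $e\mapsto e'$ from $E$ to $E$ such that, for all $e,f\in E$: (i) $(e')'=e$; (ii) $f\,\omega^l e$ if and only if $e'\,\omega^r f'$; (iii) $f\,\omega^l e'$ if and only if $M(f,e)=\{0\}$; - (E3) for all $e,f\in E$, if $f\,\omega\,e'$ then $S(e',f')\cap S(f',e')\neq\emptyset$. If $e,f\in E$ and $f\,\omega\,e'$, then $S(e',f')\cap S(f',e')$ contains exactly one element. Moreover, let $T$ be any regular semigroup (for each $x\in T$ there is $y\in T$ with $xyx=x$) whose biordered set of idempotents is isomorphic to $E$. Here the biordered set of idempotents of $T$ is the set of idempotents of $T$ with the product of $T$ restricted to the pairs $(a,b)$ for which at least one of $ab=a$, $ab=b$, $ba=a$, $ba=b$ holds, and an isomorphism is a bijection that preserves and reflects definedness of products and preserves their values. If $E$ is identified with the set of idempotents of $T$ along any such isomorphism, then that unique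 element is the product $e'f'$ computed in $T$. -/

import Mathlib

/-- A set with a partial binary operation: `pmul e f = some g` means that the product `ef` is
defined and equals `g`; `pmul e f = none` means that `ef` is not defined. -/
class PartialMul (E : Type*) where
  pmul : E → E → Option E

namespace PartialMul

variable {E : Type*} [PartialMul E]

/-- `e ω^l f`: the product `ef` is defined and `ef = e`. -/
def OmL (e f : E) : Prop := pmul e f = some e

/-- `e ω^r f`: the product `fe` is defined and `fe = e`. -/
def OmR (e f : E) : Prop := pmul f e = some e

/-- `ω = ω^l ∩ ω^r`. -/
def Om (e f : E) : Prop := OmL e f ∧ OmR e f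

/-- `M(e, f) = ω^l(e) ∩ ω^r(f)`. -/
def mSet (e f : E) : Set E := {g | OmL g e ∧ OmR g f}

/-- The relation `g ≼ h` on `M(e, f)`: `eg ω^r eh` and `gf ω^l hf`. -/
def SandwichLE (e f g h : E) : Prop :=
  (∃ p q, pmul e g = some p ∧ pmul e h = some q ∧ OmR p q) ∧
  (∃ p q, pmul g f = some p ∧ pmul h f = some q ∧ OmL p q)

/-- The sandwich set `S(e, f)`. -/
def sandwichSet (e f : E) : Set E :=
  {h | h ∈ mSet e f ∧ ∀ g ∈ mSet e f, SandwichLE e f g h}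

end PartialMul

open PartialMul in
/-- Nambooripad's axioms of a biordered set; each axiom `foo` is accompanied by its left-right
dual `foo_dual`. Equalities between (iterated) products are equalities in `Option E`. -/
class IsBiorderedSet (E : Type*) [PartialMul E] : Prop where
  nonempty : Nonempty E
  omL_refl : ∀ e : E, OmL e e
  omL_trans : ∀ e f g : E, OmL e f → OmL f g → OmL e g
  omR_refl : ∀ e : E, OmR e e
  omR_trans : ∀ e f g : E, OmR e f → OmR f g → OmR e g
  /-- `ef` is defined iff `(e, f)` lies in `(ω^r ∪ ω^l) ∪ (ω^r ∪ ω^l)⁻¹`. -/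
  defined_iff : ∀ e f : E,
    (∃ g, pmul e f = some g) ↔ ((OmR e f ∨ OmL e f) ∨ (OmR f e ∨ OmL f e))
  /-- If `f ω^r e` then `f R fe ω e`, where `R = ω^r ∩ (ω^r)⁻¹`. -/
  b21 : ∀ e f : E, OmR f e → ∃ p, pmul f e = some p ∧ (OmR f p ∧ OmR p f) ∧ Om p e
  b21_dual : ∀ e f : E, OmL f e → ∃ p, pmul e f = some p ∧ (OmL f p ∧ OmL p f) ∧ Om p e
  /-- If `g ω^l f` and `f, g ∈ ω^r(e)` then `ge ω^l fe`. -/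
  b22 : ∀ e f g : E, OmL g f → OmR f e → OmR g e →
    ∃ p q, pmul g e = some p ∧ pmul f e = some q ∧ OmL p q
  b22_dual : ∀ e f g : E, OmR g f → OmL f e → OmL g e →
    ∃ p q, pmul e g = some p ∧ pmul e f = some q ∧ OmR p q
  /-- If `g ω^r f ω^r e` then `gf = (ge)f`. -/
  b31 : ∀ e f g : E, OmR g f → OmR f e →
    pmul g f = (pmul g e).bind fun p => pmul p f
  b31_dual : ∀ e f g : E, OmL g f → OmL f e →
    pmul f g = (pmul e g).bind fun p => pmul f p
  /-- If `g ω^l f` and `f, g ∈ ω^r(e)` then `(fg)e = (fe)(ge)`. -/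
  b32 : ∀ e f g : E, OmL g f → OmR f e → OmR g e →
    ((pmul f g).bind fun p => pmul p e) =
      (pmul f e).bind fun p => (pmul g e).bind fun q => pmul p q
  b32_dual : ∀ e f g : E, OmR g f → OmL f e → OmL g e →
    ((pmul g f).bind fun p => pmul e p) =
      (pmul e g).bind fun p => (pmul e f).bind fun q => pmul p q
  /-- If `f, g ∈ ω^r(e)` then `S(f, g)e = S(fe, ge)`. -/
  b4 : ∀ e f g : E, OmR f e → OmR g e →
    ∃ p q, pmul f e = some p ∧ pmul g e = some q ∧
      {k | ∃ h ∈ sandwichSet f g, pmul h e = some k} = sandwichSet p q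
  b4_dual : ∀ e f g : E, OmL f e → OmL g e →
    ∃ p q, pmul e f = some p ∧ pmul e g = some q ∧
      {k | ∃ h ∈ sandwichSet f g, pmul e h = some k} = sandwichSet p q

/-- A regular biordered set: all sandwich sets are non-empty. -/
class IsRegularBiorderedSet (E : Type*) [PartialMul E] : Prop extends IsBiorderedSet E where
  sandwichSet_nonempty : ∀ e f : E, (PartialMul.sandwichSet e f).Nonempty

/-- A regular semigroup: every `x` has some `y` with `xyx = x`. -/
def IsRegularSemigroup (S : Type*) [Semigroup S] : Prop :=
  ∀ x : S, ∃ y : S, x * y * x = x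

/-- The set of idempotents of a semigroup. -/
def Idempotents (S : Type*) [Semigroup S] : Type _ := {e : S // IsIdempotentElem e}

/-- The pairs of idempotents whose product is defined in the biordered set of a semigroup. -/
def Idempotents.Compat {S : Type*} [Semigroup S] (e f : Idempotents S) : Prop :=
  (e.1 * f.1 = e.1 ∨ e.1 * f.1 = f.1) ∨ (f.1 * e.1 = e.1 ∨ f.1 * e.1 = f.1)

theorem Idempotents.Compat.isIdempotentElem {S : Type*} [Semigroup S] {e f : Idempotents S}
    (h : e.Compat f) : IsIdempotentElem (e.1 * f.1) := by
  have he : e.1 * e.1 = e.1 := e.2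
  have hf : f.1 * f.1 = f.1 := f.2
  have key : (e.1 * f.1) * (e.1 * f.1) = e.1 * (f.1 * e.1) * f.1 := by simp only [mul_assoc]
  rcases h with (h | h) | (h | h)
  · rw [h]; exact he
  · rw [h]; exact hf
  · unfold IsIdempotentElem; rw [key, h, he]
  · unfold IsIdempotentElem; rw [key, h, mul_assoc, hf]

open Classical in
/-- The partial algebra of idempotents of a semigroup `S`: the product of `e` and `f` is their
product in `S`, and is defined only when `ef` or `fe` is one of `e`, `f`. -/
noncomputable instance Idempotents.instPartialMul (S : Type*) [Semigroup S] :
    PartialMul (Idempotents S) where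
  pmul e f := if h : e.Compat f then some ⟨e.1 * f.1, h.isIdempotentElem⟩ else none

/-- Isomorphisms of partial algebras: bijections that preserve and reflect the definedness of
products, and preserve their values. -/
structure PartialMulEquiv (E F : Type*) [PartialMul E] [PartialMul F] extends E ≃ F where
  map_pmul : ∀ a b : E,
    PartialMul.pmul (toEquiv a) (toEquiv b) = (PartialMul.pmul a b).map toEquiv

open PartialMul

/-! Write a = e′ and b = f′. An element h of S(a, b) ∩ S(b, a) lies in M(a, b) and in M(b, a), so it
is fixed by a and b on both sides. The preorder defining S(a, b) therefore reduces to ω on the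
intersection: any two members lie below each other, hence coincide. Existence is the assumption on
sandwich sets. In a regular semigroup, any h in S(a, b) satisfies ahb = ab. An inverse of ab yields
some g in M(a, b) with agb = ab, and maximality of h carries this over to h. As also ah = h = hb,
the product ab is h itself. -/

/-- If `h ω^l k` and `k ω^r h`, then `h = hk = k`. -/
theorem PartialMul.eq_of_omL_of_omR {E : Type*} [PartialMul E] {h k : E}
    (hl : OmL h k) (hr : OmR k h) : h = k :=
  Option.some.inj (hl.symm.trans hr)

/-- Any two elements `k`, `h` of `S(a, b) ∩ S(b, a)` satisfy `k ω h`. -/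
theorem PartialMul.om_of_mem_sandwichSet_inter {E : Type*} [PartialMul E] {a b h k : E}
    (hh : h ∈ sandwichSet a b ∩ sandwichSet b a) (hk : k ∈ sandwichSet a b ∩ sandwichSet b a) :
    Om k h := by
  obtain ⟨⟨⟨-, -⟩, hmax⟩, ⟨hhb, hha⟩, -⟩ := hh
  obtain ⟨⟨hkM, -⟩, ⟨hkb, hka⟩, -⟩ := hk
  obtain ⟨⟨p, q, hp, hq, hpq⟩, ⟨r, s, hr, hs, hrs⟩⟩ := hmax k hkM
  -- Membership in M(b, a) gives ak = k, ah = h, kb = k and hb = h, so maximality compares k and h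
  -- themselves.
  obtain rfl : p = k := Option.some.inj (hp.symm.trans hka)
  obtain rfl : q = h := Option.some.inj (hq.symm.trans hha)
  obtain rfl : r = p := Option.some.inj (hr.symm.trans hkb)
  obtain rfl : s = q := Option.some.inj (hs.symm.trans hhb)
  exact ⟨hrs, hpq⟩

/-- The set `S(a, b) ∩ S(b, a)` has at most one element. -/
theorem PartialMul.sandwichSet_inter_subsingleton {E : Type*} [PartialMul E] (a b : E) :
    (sandwichSet a b ∩ sandwichSet b a).Subsingleton := fun _ hh _ hk =>
  eq_of_omL_of_omR (om_of_mem_sandwichSet_inter hk hh).1 (om_of_mem_sandwichSet_inter hh hk).2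

open Classical in
/-- A defined product of idempotents is their product in the semigroup. -/
theorem Idempotents.mul_eq_of_pmul_eq_some {S : Type*} [Semigroup S] {a b c : Idempotents S}
    (h : pmul a b = some c) : a.1 * b.1 = c.1 := by
  change (if h : a.Compat b then some ⟨a.1 * b.1, h.isIdempotentElem⟩ else none) = some c at h
  split_ifs at h
  exact congrArg Subtype.val (Option.some.inj h)

open Classical in
theorem Idempotents.omL_of_mul_eq {S : Type*} [Semigroup S] {a b : Idempotents S}
    (h : a.1 * b.1 = a.1) : OmL a b := by
  change (if h : a.Compat b then some ⟨a.1 * b.1, h.isIdempotentElem⟩ else none) = some a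
  rw [dif_pos (.inl (.inl h))]
  exact congrArg some (Subtype.ext h)

open Classical in
theorem Idempotents.omR_of_mul_eq {S : Type*} [Semigroup S] {a b : Idempotents S}
    (h : b.1 * a.1 = a.1) : OmR a b := by
  change (if h : b.Compat a then some ⟨b.1 * a.1, h.isIdempotentElem⟩ else none) = some a
  rw [dif_pos (.inl (.inr h))]
  exact congrArg some (Subtype.ext h)

namespace PartialMulEquiv

variable {E F : Type*} [PartialMul E] [PartialMul F]

theorem pmul_eq_some_iff (φ : PartialMulEquiv E F) {a b c : E} :
    pmul (φ.toEquiv a) (φ.toEquiv b) = some (φ.toEquiv c) ↔ pmul a b = some c := by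
  rw [φ.map_pmul, Option.map_eq_some_iff]
  exact ⟨fun ⟨_, hd, hdc⟩ => φ.toEquiv.injective hdc ▸ hd, fun h => ⟨c, h, rfl⟩⟩

theorem mul_eq {S : Type*} [Semigroup S] (φ : PartialMulEquiv E (Idempotents S)) {a b c : E}
    (h : pmul a b = some c) : (φ.toEquiv a).1 * (φ.toEquiv b).1 = (φ.toEquiv c).1 :=
  Idempotents.mul_eq_of_pmul_eq_some (φ.pmul_eq_some_iff.2 h)

end PartialMulEquiv

/-- In a regular semigroup, idempotents `a`, `b` admit an idempotent `g` with `ga = g = bg` and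
`agb = ab`. -/
theorem IsRegularSemigroup.exists_idempotent {S : Type*} [Semigroup S]
    (hS : IsRegularSemigroup S) (a b : Idempotents S) :
    ∃ g : Idempotents S, g.1 * a.1 = g.1 ∧ b.1 * g.1 = g.1 ∧ a.1 * g.1 * b.1 = a.1 * b.1 := by
  obtain ⟨a, ha⟩ := a
  obtain ⟨b, hb⟩ := b
  obtain ⟨y, hy⟩ := hS (a * b)
  -- If y satisfies (ab)y(ab) = ab, then y(ab)y is an inverse of ab.
  obtain ⟨x, hx, hx'⟩ : ∃ x, (a * b) * x * (a * b) = a * b ∧ x * (a * b) * x = x := by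
    refine ⟨y * (a * b) * y, ?_, ?_⟩
    · calc _ = ((a * b) * y * (a * b)) * y * (a * b) := by simp only [mul_assoc]
        _ = _ := by rw [hy, hy]
    · calc _ = y * (((a * b) * y * (a * b)) * y * (a * b)) * y := by simp only [mul_assoc]
        _ = _ := by rw [hy, hy]
  -- The witness bxa is idempotent because x(ab)x = x.
  refine ⟨⟨b * x * a, ?_⟩, ?_, ?_, ?_⟩
  · calc _ = b * (x * (a * b) * x) * a := by simp only [mul_assoc]
      _ = _ := by rw [hx']
  · change b * x * a * a = b * x * a
    rw [mul_assoc, ha.eq]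
  · change b * (b * x * a) = b * x * a
    rw [← mul_assoc, ← mul_assoc, hb.eq]
  · calc _ = (a * b) * x * (a * b) := by simp only [mul_assoc]
      _ = _ := hx

/-- If `h ∈ S(a, b)`, then `ahb = ab` in every regular semigroup whose biordered set of idempotents
is identified with `E`. -/
theorem PartialMulEquiv.mul_mul_eq_of_mem_sandwichSet {E : Type*} [PartialMul E] {S : Type*}
    [Semigroup S] (hS : IsRegularSemigroup S) (φ : PartialMulEquiv E (Idempotents S)) {a b h : E}
    (hh : h ∈ sandwichSet a b) :
    (φ.toEquiv a).1 * (φ.toEquiv h).1 * (φ.toEquiv b).1 =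
      (φ.toEquiv a).1 * (φ.toEquiv b).1 := by
  obtain ⟨⟨hha, -⟩, hmax⟩ := hh
  obtain ⟨g, hga, hbg, hagb⟩ := hS.exists_idempotent (φ.toEquiv a) (φ.toEquiv b)
  obtain ⟨g, rfl⟩ := φ.toEquiv.surjective g
  -- Maximality of h against g gives ag ω^r ah, that is, (ah)(ag) = ag.
  obtain ⟨⟨p, q, hp, hq, hpq⟩, -⟩ := hmax g
    ⟨φ.pmul_eq_some_iff.1 (Idempotents.omL_of_mul_eq hga),
      φ.pmul_eq_some_iff.1 (Idempotents.omR_of_mul_eq hbg)⟩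
  have key := φ.mul_eq hpq
  rw [← φ.mul_eq hp, ← φ.mul_eq hq] at key
  have hha := φ.mul_eq hha
  generalize (φ.toEquiv a).1 = a at *
  generalize (φ.toEquiv b).1 = b at *
  generalize (φ.toEquiv g).1 = g at *
  generalize (φ.toEquiv h).1 = h at *
  -- Inserting a after h exposes a factor ab, which is replaced by agb; then ag absorbs ah.
  calc a * h * b = a * (h * a) * b := by rw [hha]
    _ = a * h * (a * g * b) := by rw [hagb]; simp only [mul_assoc]
    _ = (a * h) * (a * g) * b := by simp only [mul_assoc]
    _ = a * b := by rw [key, hagb]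

theorem proposition5p2 {E : Type*} [PartialMul E] [IsRegularBiorderedSet E]
    -- a least element for ω
    (zero : E) (zero_om : ∀ e : E, Om zero e)
    -- the map e ↦ e′
    (compl : E → E)
    (compl_compl : ∀ e : E, compl (compl e) = e)
    (omL_iff : ∀ e f : E, OmL f e ↔ OmR (compl e) (compl f))
    (omL_compl_iff : ∀ e f : E, OmL f (compl e) ↔ mSet f e = {zero})
    -- S(e′, f′) ∩ S(f′, e′) is non-empty whenever f ω e′
    (sandwich_inter_nonempty : ∀ e f : E, Om f (compl e) →
      (sandwichSet (compl e) (compl f) ∩ sandwichSet (compl f) (compl e)).Nonempty)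
    (e f : E) (hfe : Om f (compl e)) :
    (∃! h : E, h ∈ sandwichSet (compl e) (compl f) ∩ sandwichSet (compl f) (compl e)) ∧
    ∀ (S : Type*) [Semigroup S], IsRegularSemigroup S →
      ∀ (φ : PartialMulEquiv E (Idempotents S)) (h : E),
        h ∈ sandwichSet (compl e) (compl f) ∩ sandwichSet (compl f) (compl e) →
          (φ.toEquiv h).1 = (φ.toEquiv (compl e)).1 * (φ.toEquiv (compl f)).1 := by
  obtain ⟨k, hk⟩ := sandwich_inter_nonempty e f hfe
  refine ⟨⟨k, hk, fun l hl => sandwichSet_inter_subsingleton _ _ hl hk⟩, ?_⟩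
  intro S _ hS φ h hh
  obtain ⟨hab, ⟨hhb, hha⟩, -⟩ := hh
  -- With a = e′ and b = f′: ab = ahb = hb = h.
  rw [← φ.mul_mul_eq_of_mem_sandwichSet hS hab, φ.mul_eq hha, φ.mul_eq hhb]
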